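/- Let $(W,S)$ be a Coxeter system of finite rank with Coxeter matrix $(m_{rt})$, where $m_{rt}=\infty$ is allowed. A complex representation $V$ of $W$ is an *IR-representation* if it has a basis $\{\alpha_s\mid s\in S\}$ such that for every $s\in S$ there is a subspace $H_s\subset V$ of codimension $1$ with $s|_{H_s}=\mathrm{Id}$, and $s\cdot\alpha_s=-\alpha_s$. For $r\ne t\in S$ and $x,y\in\mathbb{C}$ let $\varrho_{x,y}$ denote $\mathbb{C}\beta_r\oplus\mathbb{C}\beta_t$ with the action $$r\beta_r=-\beta_r,\quad r\beta_t=\beta_t+x\beta_r,\quad t\beta_t=-\beta_t,\quad t\beta_r=\beta_r+y\beta_t .$$ For every $z\in\mathbb{C}$ fix $u(z)$ with $u(z)^2=z$, and $u(z)>0$ if $z>0$. Put $\rho_k=\varrho_{c,c}$ with $c=2\cos\frac{k\pi}{m_{rt}}$ (when $m_{rt}<\infty$), $\varrho_z=\varrho_{u(z),u(z)}$, $\varrho_r^t=\varrho_{1,0}$, $\varrho_t^r=\varrho_{0,1}$, and $$P_{rt}=\begin{cases}\{\rho_k\mid k\in\mathbb{N},\ 1\le k\le m_{rt}/2\}, &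 m_{rt}<\infty,\\ \{\varrho_r^t,\varrho_t^r\}\cup\{\varrho_z\mid z\in\mathbb{C}\}, & m_{rt}=\infty.\end{cases}$$ Given a family $(\delta_{rt})_{r\neq t}$ with $\delta_{rt}=\delta_{tr}\in P_{rt}$, define $\widetilde m_{rt}$ as follows: $\widetilde m_{rt}=m_{rt}/\gcd(m_{rt},k)$ if $m_{rt}<\infty$ and $\delta_{rt}=\rho_k$; if $m_{rt}=\infty$, then $\widetilde m_{rt}=n$ if $\delta_{rt}=\varrho_z$ with $z=4\cos^2\frac{k\pi}{n}$ for some coprime integers $k,n$ with $1\le k<n/2$, $\widetilde m_{rt}=2$ if $\delta_{rt}=\varrho_0$, and $\widetilde m_{rt}=\infty$ otherwise. Let $\widetilde G$ be the graph with vertex set $S$ in which $r\neq t$ are adjacent iff $\widetilde m_{rt}\ge 3$ (possibly $\infty$), and let $H_1(\widetilde G)$ be its first integral homology group, i.e. the kernel of $\partial:(r,t)\mapsto t-r$ on the group $C_1(\widetilde G)$ generated by oriented edges with $(t,r)=-(r,t)$. Then isomorphism classes of IR-representations of $(W,S)$ are in one-to-one correspondence with the set of data $$\bigl\{\bigl((\delta_{rt})_{r\ne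 t\in S},\chi\bigr)\ \big|\ \delta_{rt}=\delta_{tr}\in P_{rt}\ \ \forall r\neq t;\ \chi \text{ is a character } H_1(\widetilde G)\to\mathbb{C}^\times\bigr\}.$$ The correspondence is characterized as follows: the class of $V$ corresponds to $((\delta_{rt}),\chi)$ if and only if there are a basis $(\alpha_s)$ of $V$ as above and numbers $a_r^t\in\mathbb{C}^\times$ ($r\ne t$) such that, for all $r\neq t$, $\beta_r\mapsto a_r^t\alpha_r$, $\beta_t\mapsto a_t^r\alpha_t$ defines an isomorphism of representations of $\langle r,t\rangle$ from $\delta_{rt}$ onto the span of $\alpha_r,\alpha_t$, and $\chi$ is the restriction to $H_1(\widetilde G)$ of the character $(r,t)\mapsto a_t^r/a_r^t$ of $C_1(\widetilde G)$. -/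

import Mathlib

universe v w s

noncomputable section

namespace CoxIR

open CategoryTheory

/-! ### First integral homology of a graph -/

section Homology

variable {S : Type*} (G : SimpleGraph S)

/-- The relations `(r,t) + (t,r) = 0` between oriented edges. -/
def orientationRelations : Submodule ℤ (G.Dart →₀ ℤ) :=
  Submodule.span ℤ
    (Set.range fun d : G.Dart => Finsupp.single d (1 : ℤ) + Finsupp.single d.symm (1 : ℤ))

/-- `C₁(G)`: the abelian group generated by the oriented edges `(r,t)` of `G`, subject to
`(t,r) = -(r,t)`. -/
abbrev C1 : Type _ := (G.Dart →₀ ℤ) ⧸ orientationRelations G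

/-- The class in `C₁(G)` of an oriented edge. -/
def orientedEdge (d : G.Dart) : C1 G := (orientationRelations G).mkQ (Finsupp.single d 1)

/-- The linear map out of `C₁(G)` determined by an antisymmetric function on oriented edges. -/
def C1.lift {A : Type*} [AddCommGroup A] (f : G.Dart → A) (hf : ∀ d, f d.symm = -f d) :
    C1 G →ₗ[ℤ] A :=
  (orientationRelations G).liftQ (Finsupp.linearCombination ℤ f) (by
    rw [orientationRelations, Submodule.span_le]
    rintro _ ⟨d, rfl⟩
    simp [hf])

theorem C1.lift_orientedEdge {A : Type*} [AddCommGroup A] (f : G.Dart → A)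
    (hf : ∀ d, f d.symm = -f d) (d : G.Dart) : C1.lift G f hf (orientedEdge G d) = f d := by
  simp [C1.lift, orientedEdge]

/-- The boundary map `∂ : C₁(G) → C₀(G)`, `(r,t) ↦ t - r`. -/
def boundary : C1 G →ₗ[ℤ] (S →₀ ℤ) :=
  C1.lift G (fun d => Finsupp.single d.snd (1 : ℤ) - Finsupp.single d.fst (1 : ℤ))
    (fun d => by simp)

/-- `H₁(G) = ker ∂` (there are no simplices of dimension `2`). -/
abbrev H1 : Submodule ℤ (C1 G) := LinearMap.ker (boundary G)

/-- Characters (one-dimensional complex representations) of the group `H₁(G)`. -/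
abbrev H1Character : Type _ := Multiplicative (H1 G) →* ℂˣ

/-- For `a_r^t ∈ ℂˣ` (written `a r t`), the character of `H₁(G)` obtained by restricting
the character `(r,t) ↦ a_t^r / a_r^t` of `C₁(G)`. -/
def characterOf (a : S → S → ℂˣ) : H1Character G :=
  AddMonoidHom.toMultiplicativeLeft
    ((C1.lift G (fun d => Additive.ofMul (a d.snd d.fst / a d.fst d.snd))
      (fun d => by simp)).toAddMonoidHom.comp
        (H1 G).subtype.toAddMonoidHom)

end Homology

/-! ### The parameter sets `P_{rt}` -/

/-- Names for the two-dimensional representations of `⟨r,t⟩` that occur: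
* `rho k` is `ρ_k`;
* `arrow r t` is `ϱ_r^t`;
* `varrho z` is `ϱ_z`. -/
inductive LocalRep (S : Type*) where
  | rho (k : ℕ) : LocalRep S
  | arrow (r t : S) : LocalRep S
  | varrho (z : ℂ) : LocalRep S

/-- The first generator `r` of the dihedral group in `ϱ_{x,y}`, in the basis `(β_r, β_t)`:
`r·β_r = -β_r`, `r·β_t = β_t + x β_r`. -/
def actFst (x : ℂ) : Module.End ℂ (Fin 2 → ℂ) := Matrix.toLin' !![-1, x; 0, 1]

/-- The second generator `t` of the dihedral group in `ϱ_{x,y}`, in the basis `(β_r, β_t)`: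
`t·β_r = β_r + y β_t`, `t·β_t = -β_t`. -/
def actSnd (y : ℂ) : Module.End ℂ (Fin 2 → ℂ) := Matrix.toLin' !![1, 0; y, -1]

open Classical in
/-- The parameters `(x, y)` for which a given local representation of `⟨r,t⟩`, in the ordered
basis `(β_r, β_t)`, is `ϱ_{x,y}`. Here `m = m_{rt}` and `u z` is the chosen square root of `z`:
`ρ_k = ϱ_{c,c}` with `c = 2 cos (kπ/m)`, `ϱ_r^t = ϱ_{1,0}`, `ϱ_t^r = ϱ_{0,1}`,
`ϱ_z = ϱ_{u(z),u(z)}`. -/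
def LocalRep.params {S : Type*} (u : ℂ → ℂ) (m : ℕ) (r t : S) : LocalRep S → ℂ × ℂ
  | .rho k => (((2 * Real.cos (k * Real.pi / m) : ℝ) : ℂ), ((2 * Real.cos (k * Real.pi / m) : ℝ) : ℂ))
  | .arrow a b => if a = r ∧ b = t then (1, 0) else (0, 1)
  | .varrho z => (u z, u z)

/-- The set `P_{rt}`. As in `CoxeterMatrix`, the value `0` stands for `m_{rt} = ∞`. -/
def P {S : Type*} (M : CoxeterMatrix S) (r t : S) : Set (LocalRep S) :=
  if M r t ≠ 0 then {δ | ∃ k : ℕ, 1 ≤ k ∧ 2 * k ≤ M r t ∧ δ = .rho k}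
  else {.arrow r t, .arrow t r} ∪ Set.range .varrho

open Classical in
/-- The label `m̃_{rt}` attached to `δ_{rt}`, where `m = m_{rt}` (`0` stands for `∞`). -/
def LocalRep.mTilde {S : Type*} (m : ℕ) : LocalRep S → ℕ
  | .rho k => m / Nat.gcd m k
  | .arrow _ _ => 0
  | .varrho z =>
      if z = 0 then 2
      else if h : ∃ n : ℕ, ∃ k : ℕ, Nat.Coprime k n ∧ 1 ≤ k ∧ 2 * k < n ∧
          z = ((4 * Real.cos (k * Real.pi / n) ^ 2 : ℝ) : ℂ)
        then h.choose else 0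

theorem LocalRep.mTilde_ne_one {S : Type*} {M : CoxeterMatrix S} {r t : S} {δ : LocalRep S}
    (hδ : δ ∈ P M r t) : δ.mTilde (M r t) ≠ 1 := by
  by_cases hm : M r t = 0
  · simp only [P, hm] at hδ
    rcases δ with k | ⟨a, b⟩ | z
    · simp at hδ
    · simp [mTilde]
    · simp only [mTilde]
      split_ifs with h1 h2
      · decide
      · obtain ⟨k, -, hk, hk', -⟩ := h2.choose_spec
        omega
      · decide
  · simp only [P, ne_eq, hm, not_false_eq_true, if_true, Set.mem_ofPred_eq] at hδ
    obtain ⟨k, hk, hk', rfl⟩ := hδ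
    simp only [mTilde]
    intro h
    have h1 := Nat.eq_of_dvd_of_div_eq_one (Nat.gcd_dvd_left (M r t) k) h
    have h2 := Nat.le_of_dvd hk (Nat.gcd_dvd_right (M r t) k)
    omega

/-- A family `(δ_{rt})_{r ≠ t}` with `δ_{rt} = δ_{tr} ∈ P_{rt}`. -/
@[ext]
structure LocalData {S : Type*} (M : CoxeterMatrix S) where
  δ : ∀ r t : S, r ≠ t → LocalRep S
  mem : ∀ (r t : S) (h : r ≠ t), δ r t h ∈ P M r t
  symm : ∀ (r t : S) (h : r ≠ t), δ r t h = δ t r h.symm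

open Classical in
/-- The Coxeter matrix `(m̃_{rt})` determined by `(δ_{rt})`. -/
def LocalData.tilde {S : Type*} {M : CoxeterMatrix S} (L : LocalData M) : CoxeterMatrix S where
  M := Matrix.of fun r t => if h : r = t then 1 else (L.δ r t h).mTilde (M r t)
  isSymm := by
    ext r t
    by_cases h : r = t
    · simp [h]
    · simp [h, Ne.symm h, L.symm r t h, M.symmetric r t]
  diagonal r := by simp
  off_diagonal r t h := by simpa [h] using LocalRep.mTilde_ne_one (L.mem r t h)

/-- The underlying graph of the Coxeter graph: `r` and `t` are joined iff `m_{rt} ≥ 3`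
(possibly `m_{rt} = ∞`, encoded by `0`). -/
def coxeterGraph {S : Type*} (M : CoxeterMatrix S) : SimpleGraph S where
  Adj r t := r ≠ t ∧ M r t ≠ 2
  symm := ⟨fun r t h => ⟨h.1.symm, by rw [M.symmetric t r]; exact h.2⟩⟩
  loopless := ⟨fun _ h => h.1 rfl⟩

/-- The graph `G̃` determined by `(δ_{rt})`. -/
def LocalData.graph {S : Type*} {M : CoxeterMatrix S} (L : LocalData M) : SimpleGraph S :=
  coxeterGraph L.tilde

/-- A classifying datum `((δ_{rt})_{r ≠ t}, χ)`, with `χ` a character of `H₁(G̃)`. -/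
structure Datum {S : Type*} (M : CoxeterMatrix S) where
  loc : LocalData M
  χ : H1Character loc.graph

/-! ### IR-representations -/

section Rep

variable {S : Type*} {M : CoxeterMatrix S} {W : Type*} [Group W] (cs : CoxeterSystem M W)
  {V : Type*} [AddCommGroup V] [Module ℂ V] (ρ : Representation ℂ W V)

/-- The basis `(α_s)` of `V` satisfies (IR): for every `s` there is a subspace `H_s` of
codimension `1` fixed pointwise by `s`, and `s·α_s = -α_s`. -/
def IsIRBasis (α : Module.Basis S ℂ V) : Prop :=
  ∀ s : S, (∃ H : Submodule ℂ V, Module.finrank ℂ (V ⧸ H) = 1 ∧ ∀ v ∈ H, ρ (cs.simple s) v = v) ∧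
    ρ (cs.simple s) (α s) = -α s

/-- `V` is an IR-representation of `(W,S)`. -/
def IsIR : Prop := ∃ α : Module.Basis S ℂ V, IsIRBasis cs ρ α

/-- The span of `α_r, α_t` is, as a representation of `⟨r,t⟩`, isomorphic to the local
representation `δ` via `β_r ↦ b α_r`, `β_t ↦ c α_t`. -/
def IsLocalIso (u : ℂ → ℂ) (α : S → V) (r t : S) (δ : LocalRep S) (b c : ℂˣ) : Prop :=
  ∃ φ : (Fin 2 → ℂ) ≃ₗ[ℂ] Submodule.span ℂ {α r, α t},
    (φ ![1, 0] : V) = (b : ℂ) • α r ∧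
    (φ ![0, 1] : V) = (c : ℂ) • α t ∧
    ∀ v, (φ (actFst (δ.params u (M r t) r t).1 v) : V) = ρ (cs.simple r) (φ v) ∧
      (φ (actSnd (δ.params u (M r t) r t).2 v) : V) = ρ (cs.simple t) (φ v)

/-- The representation corresponds to the datum `((δ_{rt}), χ)`: for some basis `(α_s)` as in
(IR) and some `a_r^t ∈ ℂˣ`, the span of `α_r, α_t` is isomorphic to `δ_{rt}` via
`β_r ↦ a_r^t α_r`, `β_t ↦ a_t^r α_t`, for all `r ≠ t`, and `χ` is the restriction to `H₁(G̃)` of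
`(r,t) ↦ a_t^r / a_r^t`. -/
def CorrespondsTo (u : ℂ → ℂ) (D : Datum M) : Prop :=
  ∃ (α : Module.Basis S ℂ V) (a : S → S → ℂˣ), IsIRBasis cs ρ α ∧
    (∀ (r t : S) (h : r ≠ t), IsLocalIso cs ρ u α r t (D.loc.δ r t h) (a r t) (a t r)) ∧
    D.χ = characterOf D.loc.graph a

end Rep

variable {S : Type*} {M : CoxeterMatrix S} {W : Type*} [Group W]

/-- The IR-representations of `(W,S)` (with underlying spaces in a fixed universe). -/
def IRRep (cs : CoxeterSystem M W) : Type _ := {V : Rep.{v} ℂ W // IsIR cs V.ρ}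

/-- Isomorphism of representations of `W`. -/
instance IRRep.setoid (cs : CoxeterSystem M W) : Setoid (IRRep.{v} cs) :=
  (isIsomorphicSetoid (Rep.{v} ℂ W)).comap Subtype.val

/-- The isomorphism classes of IR-representations of `(W,S)`. -/
def IRIsoClass (cs : CoxeterSystem M W) : Type _ := Quotient (IRRep.setoid.{v} cs)

/-- The isomorphism class of an IR-representation. -/
def IRRep.isoClass {cs : CoxeterSystem M W} (V : IRRep.{v} cs) : IRIsoClass.{v} cs :=
  Quotient.mk (IRRep.setoid.{v} cs) V

end CoxIR

end

noncomputable section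

namespace CoxIR

open CategoryTheory

/-! ### Characters of the first homology of a graph -/

section HomologyLemmas

variable {S : Type*} (G : SimpleGraph S)

/-! In a basis satisfying (IR), the generators act by `s·α_t = α_t + A_{st} α_s` with `A_{ss} = -2`,
so the representation is encoded by the matrix `A`. The defining relations of `W` constrain only the
pairs `(A_{rt}, A_{tr})`; the condition is `Admissible`. Since `α_s` spans the `(-1)`-eigenspace of
`s`, the basis is unique up to scaling each vector. Isomorphism classes are therefore admissible
matrices modulo `A_{rt} ↦ A_{rt} l_t / l_r`.

For a single pair `(x, y)`, the invariants of scaling are the product `xy` and which of `x`, `y`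
vanish. The set `P_{rt}` contains exactly one representative of each admissible class
(`existsUnique_localRep`), and this gives `δ_{rt}`. Once `δ` is fixed, the rest of `A` is carried by
the ratios `a_t^r / a_r^t` on the pairs with `(A_{rt}, A_{tr}) ≠ (0, 0)`. These pairs are the edges
of `G̃` (`LocalData.graph_adj_iff`), so the ratios form a character of `C₁(G̃)`.

Scaling the basis multiplies this character by a coboundary `l_t / l_r`. As `ℂˣ` is divisible,
characters extend from subgroups of abelian groups. Hence characters of `C₁` modulo coboundaries are
the characters of `H₁` (`exists_eq_characterOf`, `characterOf_eq_iff`). -/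

theorem baer_additive_complex_units : Module.Baer ℤ (Additive ℂˣ) := by
  have hsurj : Function.Surjective (fun z : ℂ =>
      (Additive.ofMul (Units.mk0 (Complex.exp z) (Complex.exp_ne_zero z)) : Additive ℂˣ)) := by
    intro y
    refine ⟨Complex.log ((Additive.toMul y : ℂˣ) : ℂ), ?_⟩
    apply Additive.toMul.injective
    ext
    simp [Complex.exp_log]
  have : DivisibleBy (Additive ℂˣ) ℤ := hsurj.divisibleBy _ (fun z n => by
    apply Additive.toMul.injective
    ext
    simp [Complex.exp_int_mul])
  exact Module.Baer.of_divisible _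

theorem exists_extension {N : Type*} [AddCommGroup N] (p : Submodule ℤ N)
    (f : p →ₗ[ℤ] Additive ℂˣ) : ∃ g : N →ₗ[ℤ] Additive ℂˣ, ∀ x : p, g x = f x := by
  obtain ⟨g, hg⟩ := baer_additive_complex_units.extension_property p.subtype
    p.injective_subtype f
  exact ⟨g, fun x => LinearMap.congr_fun hg x⟩

theorem orientedEdge_symm (d : G.Dart) : orientedEdge G d.symm = -orientedEdge G d := by
  rw [eq_neg_iff_add_eq_zero, add_comm]
  simp only [orientedEdge]
  rw [← map_add, Submodule.mkQ_apply, Submodule.Quotient.mk_eq_zero]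
  exact Submodule.subset_span ⟨d, rfl⟩

theorem C1.hom_ext {A : Type*} [AddCommGroup A] {f g : C1 G →ₗ[ℤ] A}
    (h : ∀ d, f (orientedEdge G d) = g (orientedEdge G d)) : f = g := by
  apply Submodule.linearMap_qext
  apply Finsupp.lhom_ext
  intro d n
  have : (Finsupp.single d n : G.Dart →₀ ℤ) = n • Finsupp.single d 1 := by simp
  rw [this, map_smul, map_smul]
  exact congrArg (n • ·) (h d)

/-- The character `(r,t) ↦ a_t^r / a_r^t` of `C₁(G)`. -/
def edgeCharacter (a : S → S → ℂˣ) : C1 G →ₗ[ℤ] Additive ℂˣ :=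
  C1.lift G (fun d => Additive.ofMul (a d.snd d.fst / a d.fst d.snd)) (fun d => by simp)

theorem edgeCharacter_orientedEdge (a : S → S → ℂˣ) (d : G.Dart) :
    edgeCharacter G a (orientedEdge G d) = Additive.ofMul (a d.snd d.fst / a d.fst d.snd) :=
  C1.lift_orientedEdge G _ _ d

theorem eq_characterOf_iff (χ : H1Character G) (a : S → S → ℂˣ) :
    χ = characterOf G a ↔
      ∀ x : H1 G, χ (Multiplicative.ofAdd x) = (edgeCharacter G a x).toMul := by
  constructor
  · rintro rfl x
    rfl
  · intro h
    exact MonoidHom.ext fun x => h x.toAdd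

/-- A condition on the values `a r t`, `a t r` symmetric in `r`, `t` can be satisfied for all
pairs simultaneously if it can be satisfied for every pair. -/
theorem exists_forall_pair {X : Type*} [Nonempty X] (Q : ∀ r t : S, r ≠ t → X → X → Prop)
    (hsymm : ∀ r t h b c, Q r t h b c → Q t r h.symm c b)
    (hex : ∀ r t h, ∃ b c, Q r t h b c) :
    ∃ a : S → S → X, ∀ r t h, Q r t h (a r t) (a t r) := by
  classical
  -- A total order selects one ordering of each pair, so the choices for `(r, t)` and `(t, r)` are
  -- compatible; the diagonal value is irrelevant.
  let _ : LinearOrder S := IsWellOrder.linearOrder (WellOrderingRel (α := S))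
  choose b c hbc using hex
  refine ⟨fun r t => if h : r < t then b r t h.ne else
    if h' : t < r then c t r h'.ne else Classical.arbitrary X, fun r t h => ?_⟩
  rcases lt_or_gt_of_ne h with hlt | hlt
  · simpa [hlt, not_lt_of_gt hlt] using hbc r t h
  · simpa [hlt, not_lt_of_gt hlt] using hsymm _ _ _ _ _ (hbc t r h.symm)

/-- Divisibility of `ℂˣ` extends `χ` to `C₁(G)`, and any values on oriented edges that are inverse
under reversal are ratios `a_t^r / a_r^t`. -/
theorem exists_eq_characterOf (χ : H1Character G) : ∃ a, χ = characterOf G a := by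
  obtain ⟨g, hg⟩ := exists_extension (H1 G)
    (AddMonoidHom.toMultiplicativeLeft.symm χ).toIntLinearMap
  obtain ⟨a, ha⟩ := exists_forall_pair (S := S) (X := ℂˣ)
    (fun r t _ b c => ∀ h : G.Adj r t, c / b = (g (orientedEdge G ⟨(r, t), h⟩)).toMul)
    (fun r t hne b c hbc h => by
      have h1 := hbc h.symm
      have h2 : (⟨(t, r), h⟩ : G.Dart) = SimpleGraph.Dart.symm ⟨(r, t), h.symm⟩ := rfl
      rw [h2, orientedEdge_symm, map_neg, toMul_neg, ← h1, inv_div])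
    (fun r t hne => by
      by_cases h : G.Adj r t
      · exact ⟨1, (g (orientedEdge G ⟨(r, t), h⟩)).toMul, fun _ => by simp⟩
      · exact ⟨1, 1, fun h' => absurd h' h⟩)
  refine ⟨a, (eq_characterOf_iff G χ a).2 fun x => ?_⟩
  have hga : g = edgeCharacter G a := C1.hom_ext G fun d => by
    rw [edgeCharacter_orientedEdge]
    exact Additive.toMul.injective (ha d.fst d.snd d.adj.ne d.adj).symm
  rw [← hga, hg]
  rfl

/-- Two characters of `C₁(G)` have the same restriction to `H₁(G)` iff they differ by a
coboundary. -/
theorem characterOf_eq_iff (a a' : S → S → ℂˣ) :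
    characterOf G a = characterOf G a' ↔ ∃ l : S → ℂˣ, ∀ r t, G.Adj r t →
      a t r / a r t = a' t r / a' r t * (l t / l r) := by
  rw [eq_characterOf_iff]
  change (∀ x : H1 G, (edgeCharacter G a x).toMul = (edgeCharacter G a' x).toMul) ↔ _
  constructor
  · intro h
    -- The difference vanishes on `ker ∂`, so it factors through `im ∂`. Extending it to `C₀(G)` and
    -- evaluating at the vertices gives `l`.
    set f := edgeCharacter G a - edgeCharacter G a' with hf
    have hker : LinearMap.ker (boundary G) ≤ LinearMap.ker f := fun x hx => by
      have : edgeCharacter G a x = edgeCharacter G a' x := Additive.toMul.injective (h ⟨x, hx⟩)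
      simp [hf, this]
    obtain ⟨g, hg⟩ := exists_extension (LinearMap.range (boundary G))
      (((LinearMap.ker (boundary G)).liftQ f hker).comp
        (boundary G).quotKerEquivRange.symm.toLinearMap)
    have key : ∀ x, g (boundary G x) = f x := fun x => by
      have h1 := hg ⟨boundary G x, x, rfl⟩
      rw [h1]
      have h2 : (boundary G).quotKerEquivRange.symm ⟨boundary G x, x, rfl⟩
          = (LinearMap.ker (boundary G)).mkQ x := by
        rw [LinearEquiv.symm_apply_eq]
        rfl
      simp only [LinearMap.comp_apply, LinearEquiv.coe_coe]
      rw [h2]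
      simp
    refine ⟨fun s => (g (Finsupp.single s 1)).toMul, fun r t hrt => ?_⟩
    have h3 := key (orientedEdge G ⟨(r, t), hrt⟩)
    rw [boundary, C1.lift_orientedEdge, hf, LinearMap.sub_apply, edgeCharacter_orientedEdge,
      edgeCharacter_orientedEdge, map_sub] at h3
    have h4 := congrArg Additive.toMul h3
    simp only [toMul_sub, toMul_ofMul] at h4
    rw [h4, mul_div_cancel]
  · rintro ⟨l, hl⟩ ⟨x, hx⟩
    have hx' : boundary G x = 0 := hx
    set g : (S →₀ ℤ) →ₗ[ℤ] Additive ℂˣ :=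
      Finsupp.linearCombination ℤ (fun s => Additive.ofMul (l s)) with hg
    have h1 : edgeCharacter G a = edgeCharacter G a' + g.comp (boundary G) :=
      C1.hom_ext G fun d => by
        rw [LinearMap.add_apply, LinearMap.comp_apply, edgeCharacter_orientedEdge,
          edgeCharacter_orientedEdge, boundary, C1.lift_orientedEdge]
        apply Additive.toMul.injective
        simpa [hg] using hl d.fst d.snd d.adj
    simp [h1, hx']

end HomologyLemmas

/-! ### The relation `(RT)^m = 1` for two reflections -/

section Dihedral

/-- The condition on `r·α_t = α_t + x α_r`, `t·α_r = α_r + y α_t` equivalent to the braid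
relation of order `m` (`0` stands for `∞`). -/
def Admissible (m : ℕ) (x y : ℂ) : Prop :=
  m ≠ 0 → (∃ k : ℕ, 1 ≤ k ∧ 2 * k ≤ m ∧
    x * y = ((2 * Real.cos (k * Real.pi / m) : ℝ) : ℂ) ^ 2) ∧ (x * y = 0 → x = 0 ∧ y = 0)

variable {V : Type*} [AddCommGroup V] [Module ℂ V] {x y : ℂ} {a b : V}

theorem pow_apply_of_eigen {G : Module.End ℂ V} {z : ℂ} {v : V} (h : G v = z • v) (n : ℕ) :
    (G ^ n) v = z ^ n • v := by
  induction n with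
  | zero => simp
  | succ n ih => rw [pow_succ', Module.End.mul_apply, ih, map_smul, h, smul_smul, pow_succ]

theorem pow_apply_of_jordan {G : Module.End ℂ V} {z : ℂ} {v w : V} (hv : G v = z • v)
    (hw : G w = z • w + z • v) (n : ℕ) : (G ^ n) w = z ^ n • (w + (n : ℂ) • v) := by
  induction n with
  | zero => simp
  | succ n ih =>
    rw [pow_succ', Module.End.mul_apply, ih, map_smul, map_add, map_smul, hv, hw]
    push_cast
    module

/-- A nontrivial Jordan block has infinite order. -/
theorem eq_zero_of_jordan {G : Module.End ℂ V} {z : ℂ} {v w : V}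
    (hv : G v = z • v) (hw : G w = z • w + z • v) {m : ℕ} (hm : m ≠ 0) (hG : G ^ m = 1) :
    v = 0 := by
  by_contra hv0
  have h1 := pow_apply_of_eigen hv m
  have h2 := pow_apply_of_jordan hv hw m
  rw [hG, Module.End.one_apply] at h1 h2
  have hzm : z ^ m = 1 := by
    have : (1 : ℂ) • v = z ^ m • v := by rw [one_smul]; exact h1
    exact (smul_left_injective ℂ hv0 this).symm
  rw [hzm, one_smul] at h2
  have h3 : (m : ℂ) • v = 0 := by simpa using h2
  rcases smul_eq_zero.1 h3 with h | h
  · exact hm (by exact_mod_cast h)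
  · exact hv0 h

/-- The equation says `z + z⁻¹ = q - 2`. With `w = exp(ijπ/m)` and `w² = z`, this becomes `q = (w +
w⁻¹)²`. -/
theorem cos_sq_eq_of_root {m j : ℕ} (hm : m ≠ 0) {q z : ℂ}
    (hz : Complex.exp (2 * Real.pi * Complex.I / m) ^ j = z) (hq : z ^ 2 - (q - 2) * z + 1 = 0) :
    q = ((2 * Real.cos (j * Real.pi / m) : ℝ) : ℂ) ^ 2 := by
  have hm' : (m : ℂ) ≠ 0 := by exact_mod_cast hm
  set w := Complex.exp ((j * Real.pi / m : ℂ) * Complex.I) with hw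
  have hw0 : w ≠ 0 := Complex.exp_ne_zero _
  have hzw : z = w ^ 2 := by
    rw [← hz, hw, ← Complex.exp_nat_mul, ← Complex.exp_nat_mul]
    congr 1
    push_cast
    field_simp
  have hc : ((2 * Real.cos (j * Real.pi / m) : ℝ) : ℂ) = w + w⁻¹ := by
    push_cast
    rw [Complex.two_cos, hw, ← Complex.exp_neg, neg_mul]
  rw [hc]
  rw [hzw] at hq
  have : q * w ^ 2 = (w ^ 2 + 1) ^ 2 := by linear_combination -hq
  field_simp
  linear_combination this

/-- On the plane spanned by `a`, `b`, the product `RT` has trace `xy - 2` and determinant `1`.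
Finite order forces its eigenvalues to be `m`-th roots of unity and excludes Jordan blocks. -/
theorem admissible_of_pow_eq_one {R T : Module.End ℂ V} (hab : LinearIndependent ℂ ![a, b])
    (hRa : R a = -a) (hRb : R b = b + x • a) (hTb : T b = -b) (hTa : T a = a + y • b) {m : ℕ}
    (hG : (R * T) ^ m = 1) : Admissible m x y := by
  intro hm
  have ha : a ≠ 0 := by simpa using hab.ne_zero 0
  have hb : b ≠ 0 := by simpa using hab.ne_zero 1
  have hGa : (R * T) a = (x * y - 1) • a + y • b := by
    rw [Module.End.mul_apply, hTa, map_add, map_smul, hRa, hRb]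
    module
  have hGb : (R * T) b = (-x) • a - b := by
    rw [Module.End.mul_apply, hTb, map_neg, hRb]
    module
  by_cases hxy : x * y = 0
  -- Here `-1` is a double eigenvalue, and a nonzero `x` or `y` would produce a Jordan block. Then
  -- `(-1)^m = 1` makes `m` even, and `k = m/2`.
  · have hx : x = 0 := by
      by_contra hx
      have hy : y = 0 := (mul_eq_zero.1 hxy).resolve_left hx
      have := eq_zero_of_jordan (G := R * T) (z := -1) (v := x • a) (w := b)
        (by rw [map_smul, hGa, hxy, hy]; module) (by rw [hGb]; module) hm hG
      exact (smul_ne_zero hx ha) this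
    have hy : y = 0 := by
      by_contra hy
      have := eq_zero_of_jordan (G := R * T) (z := -1) (v := -y • b) (w := a)
        (by rw [map_smul, hGb, hx]; module) (by rw [hGa, hxy]; module) hm hG
      exact (smul_ne_zero (neg_ne_zero.2 hy) hb) this
    refine ⟨?_, fun _ => ⟨hx, hy⟩⟩
    have h1 := pow_apply_of_eigen (G := R * T) (z := -1) (v := a) (by rw [hGa, hxy, hy]; module) m
    rw [hG, Module.End.one_apply] at h1
    have h2 : (-1 : ℂ) ^ m = 1 := by
      have : (1 : ℂ) • a = (-1 : ℂ) ^ m • a := by rw [one_smul]; exact h1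
      exact (smul_left_injective ℂ ha this).symm
    have h3 : Even m := by
      by_contra h
      rw [(Nat.not_even_iff_odd.1 h).neg_one_pow] at h2
      norm_num at h2
    obtain ⟨k, rfl⟩ := h3
    have hk : (k : ℝ) ≠ 0 := by
      intro h
      apply hm
      have : k = 0 := by exact_mod_cast h
      omega
    refine ⟨k, by omega, by omega, ?_⟩
    have : (k * Real.pi / ((k + k : ℕ) : ℝ)) = Real.pi / 2 := by
      push_cast
      field_simp
      ring
    rw [hxy, this]
    simp
  · have hx : x ≠ 0 := left_ne_zero_of_mul hxy
    refine ⟨?_, fun h => absurd h hxy⟩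
    obtain ⟨z, hz⟩ : ∃ z : ℂ, z ^ 2 - (x * y - 2) * z + 1 = 0 := by
      obtain ⟨d, hd⟩ := IsAlgClosed.exists_pow_nat_eq ((x * y - 2) ^ 2 - 4) (n := 2) (by norm_num)
      exact ⟨(x * y - 2 + d) / 2, by linear_combination hd / 4⟩
    set v := x • a + (x * y - 1 - z) • b with hv
    have hv0 : v ≠ 0 := by
      intro h
      have := LinearIndependent.pair_iff.1 hab x _ h
      exact hx this.1
    have hGv : (R * T) v = z • v := by
      rw [hv, map_add, map_smul, map_smul, hGa, hGb]
      have h1 : z * (x * y - 1 - z) = 1 + z := by linear_combination -hz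
      rw [smul_add z, smul_smul z _ b, h1]
      module
    have hzm : z ^ m = 1 := by
      have h1 := pow_apply_of_eigen hGv m
      rw [hG, Module.End.one_apply] at h1
      have : (1 : ℂ) • v = z ^ m • v := by rw [one_smul]; exact h1
      exact (smul_left_injective ℂ hv0 this).symm
    have : NeZero m := ⟨hm⟩
    obtain ⟨j, hj, hjz⟩ := (Complex.isPrimitiveRoot_exp m hm).eq_pow_of_pow_eq_one hzm
    -- The eigenvalue `1` would mean `xy = 4`, where `RT` is unipotent but not the identity on the
    -- plane.
    have hj0 : j ≠ 0 := by
      rintro rfl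
      rw [pow_zero] at hjz
      subst hjz
      have h4 : x * y = 4 := by linear_combination -hz
      apply hv0
      have := eq_zero_of_jordan (G := R * T) (z := 1) (v := -v) (w := b)
        (by rw [map_neg, hGv, smul_neg]) (by rw [hGb, hv, h4]; module) hm hG
      exact neg_eq_zero.1 this
    have hq := cos_sq_eq_of_root hm hjz hz
    -- The exponents `j` and `m - j` belong to the inverse eigenvalues `z`, `z⁻¹` and give the same
    -- squared cosine.
    by_cases h : 2 * j ≤ m
    · exact ⟨j, by omega, h, hq⟩
    · refine ⟨m - j, by omega, by omega, ?_⟩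
      rw [hq, Nat.cast_sub hj.le]
      have : ((m : ℝ) - j) * Real.pi / m = Real.pi - j * Real.pi / m := by
        have : (m : ℝ) ≠ 0 := by exact_mod_cast hm
        field_simp
      rw [this, Real.cos_pi_sub]
      push_cast
      ring

/-- The image of `RT - 1` lies in the span of `a`, `b`, where `RT` satisfies `X² - (xy - 2)X + 1`;
hence `(X - z)(X - z⁻¹)(X - 1)` annihilates `RT` on all of `V`. For `2k < m` its roots are distinct
`m`-th roots of unity, so it divides `X^m - 1`. For `2k = m` the roots collide, but then `x = y = 0`
and `(RT)² = 1`. -/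
theorem pow_eq_one_of_admissible {R T : Module.End ℂ V} {f g : V → ℂ}
    (hR : ∀ v, R v = v + f v • a) (hT : ∀ v, T v = v + g v • b)
    (hRa : R a = -a) (hRb : R b = b + x • a) (hTb : T b = -b) (hTa : T a = a + y • b) {m : ℕ}
    (h : Admissible m x y) : (R * T) ^ m = 1 := by
  by_cases hm : m = 0
  · simp [hm]
  obtain ⟨⟨k, hk, hkm, hxy⟩, h0⟩ := h hm
  have hm' : (m : ℂ) ≠ 0 := by exact_mod_cast hm
  have hGa : (R * T) a = (x * y - 1) • a + y • b := by
    rw [Module.End.mul_apply, hTa, map_add, map_smul, hRa, hRb]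
    module
  have hGb : (R * T) b = (-x) • a - b := by
    rw [Module.End.mul_apply, hTb, map_neg, hRb]
    module
  have hGv : ∀ v, (R * T) v = v + (g v • b + f (T v) • a) := fun v => by
    rw [Module.End.mul_apply, hR, hT v, add_assoc]
  set w := Complex.exp ((k * Real.pi / m : ℂ) * Complex.I) with hw
  have hw0 : w ≠ 0 := Complex.exp_ne_zero _
  have hc : ((2 * Real.cos (k * Real.pi / m) : ℝ) : ℂ) = w + w⁻¹ := by
    push_cast
    rw [Complex.two_cos, hw, ← Complex.exp_neg, neg_mul]
  rw [hc] at hxy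
  have hwm : (w ^ 2) ^ m = 1 := by
    rw [← pow_mul, hw, ← Complex.exp_nat_mul, Complex.exp_eq_one_iff]
    exact ⟨k, by push_cast; field_simp⟩
  have hsum : w ^ 2 + (w ^ 2)⁻¹ = x * y - 2 := by
    rw [hxy]
    field_simp
    ring
  have hqa : (R * T) ((R * T) a) - (x * y - 2) • (R * T) a + a = 0 := by
    rw [hGa, map_add, map_smul, map_smul, hGa, hGb]
    module
  have hqb : (R * T) ((R * T) b) - (x * y - 2) • (R * T) b + b = 0 := by
    rw [hGb, map_sub, map_smul, hGa, hGb]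
    module
  have hcube : ∀ v, (R * T) ((R * T) ((R * T) v - v)) - (x * y - 2) • (R * T) ((R * T) v - v)
      + ((R * T) v - v) = 0 := fun v => by
    have : (R * T) v - v = g v • b + f (T v) • a := by rw [hGv]; abel
    rw [this]
    have h1 : (R * T) ((R * T) (g v • b + f (T v) • a)) -
        (x * y - 2) • (R * T) (g v • b + f (T v) • a) + (g v • b + f (T v) • a) =
        g v • ((R * T) ((R * T) b) - (x * y - 2) • (R * T) b + b) +
        f (T v) • ((R * T) ((R * T) a) - (x * y - 2) • (R * T) a + a) := by
      simp only [map_add, map_smul]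
      module
    rw [h1, hqa, hqb, smul_zero, smul_zero, add_zero]
  by_cases hk2 : 2 * k = m
  · have hcos : w + w⁻¹ = 0 := by
      rw [← hc, ← hk2]
      have hk0 : (k : ℝ) ≠ 0 := by
        have : k ≠ 0 := by omega
        exact_mod_cast this
      have : (k * Real.pi / ((2 * k : ℕ) : ℝ)) = Real.pi / 2 := by
        push_cast
        field_simp
      rw [this]
      simp
    have hxy0 : x * y = 0 := by rw [hxy, hcos]; ring
    obtain ⟨hx, hy⟩ := h0 hxy0
    have hsq : (R * T) ^ 2 = 1 := by
      ext v
      rw [pow_two, Module.End.mul_apply, hGv v, map_add, map_add, map_smul, map_smul, hGv v, hGa,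
        hGb, hx, hy]
      simp only [Module.End.one_apply]
      module
    rw [← hk2, pow_mul, hsq, one_pow]
  · have hprim := Complex.isPrimitiveRoot_exp m hm
    have hwpow : ∀ n : ℕ, (w ^ 2) ^ n = Complex.exp (2 * Real.pi * Complex.I / m) ^ (k * n) := by
      intro n
      rw [← pow_mul, hw, ← Complex.exp_nat_mul, ← Complex.exp_nat_mul]
      congr 1
      push_cast
      field_simp
    have h1 : w ^ 2 ≠ 1 := fun h => by
      have h' := hwpow 1
      rw [pow_one, mul_one, h] at h'
      have := Nat.le_of_dvd (by omega) (hprim.dvd_of_pow_eq_one _ h'.symm)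
      omega
    have h2 : (w ^ 2) ^ 2 ≠ 1 := fun h => by
      have h' := hwpow 2
      rw [h] at h'
      have := Nat.le_of_dvd (by omega) (hprim.dvd_of_pow_eq_one _ h'.symm)
      omega
    set z := w ^ 2 with hz
    have hz0 : z ≠ 0 := pow_ne_zero _ hw0
    have hz1 : z⁻¹ ≠ 1 := fun h => h1 (inv_eq_one.1 h)
    have hzz : z⁻¹ ≠ z := fun h => h2 (by rw [pow_two]; nth_rw 1 [← h]; exact inv_mul_cancel₀ hz0)
    open Polynomial in
    have hdvd : (X - C z) * (X - C z⁻¹) * (X - C 1) ∣ (X ^ m - 1 : ℂ[X]) := by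
      have hcop : ∀ p q : ℂ, p ≠ q → IsCoprime (X - C p) (X - C q) := fun p q hpq =>
        isCoprime_X_sub_C_of_isUnit_sub (sub_ne_zero.2 hpq).isUnit
      refine IsCoprime.mul_dvd (IsCoprime.mul_left (hcop _ _ h1) (hcop _ _ hz1))
        (IsCoprime.mul_dvd (hcop _ _ hzz.symm) ?_ ?_) ?_ <;> rw [dvd_iff_isRoot] <;> simp [hwm]
    obtain ⟨p, hp⟩ := hdvd
    have hev := congrArg (Polynomial.aeval (R * T)) hp
    simp only [map_sub, map_pow, map_mul, Polynomial.aeval_X, map_one] at hev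
    rw [← sub_eq_zero, hev]
    have hzero : (R * T - Polynomial.aeval (R * T) (Polynomial.C z)) *
        (R * T - Polynomial.aeval (R * T) (Polynomial.C z⁻¹)) * (R * T - 1) = 0 := by
      ext v
      have hone : z * z⁻¹ = 1 := mul_inv_cancel₀ hz0
      rw [LinearMap.zero_apply, ← hcube v, ← hsum]
      clear_value z
      simp only [Polynomial.aeval_C, Module.End.mul_apply, LinearMap.sub_apply,
        Module.algebraMap_end_apply, Module.End.one_apply, map_sub, map_smul]
      linear_combination (norm := module) hone • (R (T v) - v)
    rw [hzero, zero_mul]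

end Dihedral

/-! ### `P_{rt}` as a set of representatives for pairs up to scaling -/

section LocalClassification

variable {S : Type*} {M : CoxeterMatrix S} {u : ℂ → ℂ}

theorem P_symm (r t : S) : P M r t = P M t r := by
  simp only [P, M.symmetric r t, Set.pair_comm]

theorem params_symm {r t : S} (h : r ≠ t) {δ : LocalRep S} (hδ : δ ∈ P M r t) :
    δ.params u (M t r) t r = (δ.params u (M r t) r t).swap := by
  rw [M.symmetric t r]
  rcases δ with k | ⟨a, b⟩ | z
  · rfl
  · simp only [P] at hδ
    split_ifs at hδ
    · simp at hδ
    · have : (a = r ∧ b = t) ∨ (a = t ∧ b = r) := by simpa using hδ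
      rcases this with ⟨rfl, rfl⟩ | ⟨rfl, rfl⟩ <;> simp [LocalRep.params, h, h.symm]
  · rfl

theorem two_cos_pos {m k : ℕ} (hm : 2 * k < m) : 0 < 2 * Real.cos (k * Real.pi / m) := by
  have hm0 : (0 : ℝ) < m := by exact_mod_cast (by omega : 0 < m)
  have h2 : 2 * (k : ℝ) < m := by exact_mod_cast hm
  refine mul_pos two_pos (Real.cos_pos_of_mem_Ioo ⟨?_, ?_⟩)
  · have : 0 ≤ k * Real.pi / m := by positivity
    linarith [Real.pi_pos]
  · rw [div_lt_div_iff₀ hm0 two_pos]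
    nlinarith [Real.pi_pos]

theorem two_cos_eq_zero {m k : ℕ} (hk : k ≠ 0) (hm : 2 * k = m) :
    2 * Real.cos (k * Real.pi / m) = 0 := by
  have hk0 : (k : ℝ) ≠ 0 := by exact_mod_cast hk
  have : k * Real.pi / m = Real.pi / 2 := by
    rw [← hm]
    push_cast
    field_simp
  simp [this]

theorem two_cos_sq_inj {m k l : ℕ} (hm : m ≠ 0) (hk : 2 * k ≤ m) (hl : 2 * l ≤ m)
    (h : (2 * Real.cos (k * Real.pi / m)) ^ 2 = (2 * Real.cos (l * Real.pi / m)) ^ 2) : k = l := by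
  have hm0 : (0 : ℝ) < m := by exact_mod_cast Nat.pos_of_ne_zero hm
  have mem : ∀ j : ℕ, 2 * j ≤ m → 0 ≤ j * Real.pi / m ∧ j * Real.pi / m ≤ Real.pi / 2 := by
    intro j hj
    refine ⟨by positivity, ?_⟩
    rw [div_le_div_iff₀ hm0 two_pos]
    have h2 : 2 * (j : ℝ) ≤ m := by exact_mod_cast hj
    nlinarith [Real.pi_pos]
  have pos : ∀ j : ℕ, 2 * j ≤ m → 0 ≤ Real.cos (j * Real.pi / m) := fun j hj =>
    Real.cos_nonneg_of_mem_Icc ⟨by linarith [(mem j hj).1, Real.pi_pos], (mem j hj).2⟩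
  have hcos : Real.cos (k * Real.pi / m) = Real.cos (l * Real.pi / m) := by
    have := (sq_eq_sq₀ (mul_nonneg zero_le_two (pos k hk)) (mul_nonneg zero_le_two (pos l hl))).1 h
    linarith
  have heq := Real.injOn_cos ⟨(mem k hk).1, by linarith [(mem k hk).2, Real.pi_pos]⟩
    ⟨(mem l hl).1, by linarith [(mem l hl).2, Real.pi_pos]⟩ hcos
  have hpi := Real.pi_ne_zero
  field_simp at heq
  exact_mod_cast heq

theorem sqrt_eq_zero_iff (hu : ∀ z, u z ^ 2 = z) (z : ℂ) : u z = 0 ↔ z = 0 := by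
  rw [← sq_eq_zero_iff, hu]

/-- This identifies the non-edges of `G̃`. For `ρ_k`, both sides mean `2k = m_{rt}`. In the
trigonometric case of `ϱ_z`, any chosen `n` satisfies `n > 2k ≥ 2`, so which `n` is chosen does not
matter. -/
theorem params_eq_zero_iff (hu : ∀ z, u z ^ 2 = z) {r t : S} {δ : LocalRep S}
    (hδ : δ ∈ P M r t) : δ.params u (M r t) r t = (0, 0) ↔ δ.mTilde (M r t) = 2 := by
  rcases δ with k | ⟨a, b⟩ | z
  · simp only [P] at hδ
    split_ifs at hδ with hm
    · obtain ⟨k, hk, hkm, h⟩ := hδ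
      cases h
      have hg : M r t / Nat.gcd (M r t) k = 2 ↔ 2 * k = M r t := by
        constructor
        · intro h
          have h1 := Nat.div_mul_cancel (Nat.gcd_dvd_left (M r t) k)
          have h2 := Nat.le_of_dvd hk (Nat.gcd_dvd_right (M r t) k)
          rw [h] at h1
          omega
        · intro h
          rw [← h, Nat.gcd_eq_right (Dvd.intro_left 2 rfl), Nat.mul_div_cancel _ hk]
      simp only [LocalRep.params, LocalRep.mTilde, hg, Prod.mk.injEq, and_self,
        Complex.ofReal_eq_zero]
      refine ⟨fun h => ?_, two_cos_eq_zero (by omega)⟩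
      by_contra h'
      exact (two_cos_pos (m := M r t) (k := k) (by omega)).ne' h
    · simp at hδ
  · simp only [LocalRep.params, LocalRep.mTilde]
    split_ifs <;> simp
  · simp only [LocalRep.params, LocalRep.mTilde, Prod.mk.injEq, and_self, sqrt_eq_zero_iff hu]
    split_ifs with h0 h
    · simp [h0]
    · obtain ⟨k, -, h1, h2, -⟩ := h.choose_spec
      exact iff_of_false h0 (by omega)
    · simp [h0]

/-- `β_r ↦ b α_r`, `β_t ↦ c α_t` intertwines `ϱ_p` and `ϱ_{x,y}`. -/
def Rescales (p : ℂ × ℂ) (x y : ℂ) (b c : ℂˣ) : Prop := c * x = b * p.1 ∧ b * y = c * p.2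

theorem Rescales.swap {p : ℂ × ℂ} {x y : ℂ} {b c : ℂˣ} (h : Rescales p x y b c) :
    Rescales p.swap y x c b := ⟨h.2, h.1⟩

theorem Rescales.mul_eq {p : ℂ × ℂ} {x y : ℂ} {b c : ℂˣ} (h : Rescales p x y b c) :
    x * y = p.1 * p.2 := by
  apply mul_left_cancel₀ (mul_ne_zero c.ne_zero b.ne_zero)
  linear_combination (b * y) * h.1 + b * p.1 * h.2

theorem Rescales.fst_eq_zero {p : ℂ × ℂ} {x y : ℂ} {b c : ℂˣ} (h : Rescales p x y b c) :
    x = 0 ↔ p.1 = 0 := by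
  rw [← mul_eq_zero_iff_left c.ne_zero, h.1, mul_eq_zero_iff_left b.ne_zero]

theorem Rescales.snd_eq_zero {p : ℂ × ℂ} {x y : ℂ} {b c : ℂˣ} (h : Rescales p x y b c) :
    y = 0 ↔ p.2 = 0 := h.swap.fst_eq_zero

theorem exists_rescales {p : ℂ × ℂ} {x y : ℂ} (h : x * y = p.1 * p.2) (hx : x = 0 ↔ p.1 = 0)
    (hy : y = 0 ↔ p.2 = 0) : ∃ b c, Rescales p x y b c := by
  by_cases hx0 : x = 0
  · by_cases hy0 : y = 0
    · exact ⟨1, 1, by simp [hx0, hx.1 hx0], by simp [hy0, hy.1 hy0]⟩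
    · refine ⟨Units.mk0 p.2 (mt hy.2 hy0), Units.mk0 y hy0, by simp [hx0, hx.1 hx0], ?_⟩
      simp [mul_comm]
  · refine ⟨Units.mk0 x hx0, Units.mk0 p.1 (mt hx.2 hx0), by simp [mul_comm], ?_⟩
    simpa using h

theorem admissible_of_rescales {r t : S} {δ : LocalRep S} (hδ : δ ∈ P M r t) {x y : ℂ} {b c : ℂˣ}
    (h : Rescales (δ.params u (M r t) r t) x y b c) : Admissible (M r t) x y := by
  intro hm
  simp only [P, hm, ne_eq, not_false_eq_true, if_true] at hδ
  obtain ⟨k, hk, hkm, rfl⟩ := hδ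
  refine ⟨⟨k, hk, hkm, by rw [h.mul_eq, pow_two]; rfl⟩, fun h0 => ?_⟩
  rw [h.fst_eq_zero, h.snd_eq_zero]
  rw [h.mul_eq] at h0
  exact ⟨mul_self_eq_zero.1 h0, mul_self_eq_zero.1 h0⟩

/-- Scaling preserves `xy` and the vanishing of `x` and of `y`, and `exists_rescales` shows that
these invariants are complete. For `m = ∞` the four vanishing patterns select `ϱ_0`, `ϱ_t^r`,
`ϱ_r^t` and `ϱ_{xy}`. For finite `m`, `xy` determines `k` because cosine is injective on `[0, π/2]`.
-/
theorem existsUnique_localRep (hu : ∀ z, u z ^ 2 = z) {r t : S} (hrt : r ≠ t) {x y : ℂ}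
    (h : Admissible (M r t) x y) :
    ∃! δ, δ ∈ P M r t ∧ ∃ b c, Rescales (δ.params u (M r t) r t) x y b c := by
  by_cases hm : M r t = 0
  · have hu0 := sqrt_eq_zero_iff hu
    have hP : ∀ δ, δ ∈ P M r t ↔ δ = .arrow r t ∨ δ = .arrow t r ∨ ∃ z, δ = .varrho z := by
      intro δ
      simp only [P, hm, ne_eq, not_true_eq_false, if_false, Set.mem_union, Set.mem_insert_iff,
        Set.mem_singleton_iff, Set.mem_range, or_assoc, eq_comm]
    have p1 : (LocalRep.arrow r t).params u (M r t) r t = (1, 0) := by simp [LocalRep.params]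
    have p2 : (LocalRep.arrow t r).params u (M r t) r t = (0, 1) := by
      simp [LocalRep.params, hrt, hrt.symm]
    have p3 : ∀ z, (LocalRep.varrho z).params u (M r t) r t = (u z, u z) := fun z => rfl
    by_cases hx : x = 0 <;> by_cases hy : y = 0
    · refine ⟨.varrho 0, ⟨(hP _).2 (Or.inr (Or.inr ⟨0, rfl⟩)), exists_rescales ?_ ?_ ?_⟩, ?_⟩
      · simp [p3, (hu0 0).2 rfl, hx]
      · simp [p3, (hu0 0).2 rfl, hx]
      · simp [p3, (hu0 0).2 rfl, hy]
      · rintro δ ⟨hδ, b, c, hbc⟩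
        have h1 := hbc.fst_eq_zero
        have h2 := hbc.snd_eq_zero
        rcases (hP δ).1 hδ with rfl | rfl | ⟨z, rfl⟩
        · simp [p1, hx] at h1
        · simp [p2, hy] at h2
        · simp only [p3, hx, true_iff, hu0] at h1
          rw [h1]
    · refine ⟨.arrow t r, ⟨(hP _).2 (Or.inr (Or.inl rfl)), exists_rescales ?_ ?_ ?_⟩, ?_⟩
      · simp [p2, hx]
      · simp [p2, hx]
      · simp [p2, hy]
      · rintro δ ⟨hδ, b, c, hbc⟩
        have h1 := hbc.fst_eq_zero
        have h2 := hbc.snd_eq_zero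
        rcases (hP δ).1 hδ with rfl | rfl | ⟨z, rfl⟩
        · simp [p1, hx] at h1
        · rfl
        · simp only [p3, hx, hy, true_iff, false_iff] at h1 h2
          exact absurd h1 h2
    · refine ⟨.arrow r t, ⟨(hP _).2 (Or.inl rfl), exists_rescales ?_ ?_ ?_⟩, ?_⟩
      · simp [p1, hy]
      · simp [p1, hx]
      · simp [p1, hy]
      · rintro δ ⟨hδ, b, c, hbc⟩
        have h1 := hbc.fst_eq_zero
        have h2 := hbc.snd_eq_zero
        rcases (hP δ).1 hδ with rfl | rfl | ⟨z, rfl⟩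
        · rfl
        · simp [p2, hx] at h1
        · simp only [p3, hx, hy, true_iff, false_iff] at h1 h2
          exact absurd h2 h1
    · refine ⟨.varrho (x * y), ⟨(hP _).2 (Or.inr (Or.inr ⟨_, rfl⟩)), exists_rescales ?_ ?_ ?_⟩, ?_⟩
      · rw [p3, ← pow_two, hu]
      · simp [p3, hu0, hx, hy]
      · simp [p3, hu0, hx, hy]
      · rintro δ ⟨hδ, b, c, hbc⟩
        have h1 := hbc.fst_eq_zero
        have h2 := hbc.snd_eq_zero
        rcases (hP δ).1 hδ with rfl | rfl | ⟨z, rfl⟩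
        · simp [p1, hy] at h2
        · simp [p2, hx] at h1
        · rw [hbc.mul_eq, p3, ← pow_two, hu]
  · obtain ⟨⟨k, hk, hkm, hxy⟩, h0⟩ := h hm
    have hP : ∀ δ, δ ∈ P M r t ↔ ∃ k : ℕ, 1 ≤ k ∧ 2 * k ≤ M r t ∧ δ = .rho k := by
      intro δ
      simp only [P, hm, ne_eq, not_false_eq_true, if_true]
      rfl
    refine ⟨.rho k, ⟨(hP _).2 ⟨k, hk, hkm, rfl⟩, exists_rescales ?_ ?_ ?_⟩, ?_⟩
    · rw [hxy, pow_two]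
      rfl
    · change x = 0 ↔ ((2 * Real.cos (k * Real.pi / M r t) : ℝ) : ℂ) = 0
      rw [← sq_eq_zero_iff (a := ((2 * Real.cos (k * Real.pi / M r t) : ℝ) : ℂ)), ← hxy]
      exact ⟨fun h => by rw [h, zero_mul], fun h => (h0 h).1⟩
    · change y = 0 ↔ ((2 * Real.cos (k * Real.pi / M r t) : ℝ) : ℂ) = 0
      rw [← sq_eq_zero_iff (a := ((2 * Real.cos (k * Real.pi / M r t) : ℝ) : ℂ)), ← hxy]
      exact ⟨fun h => by rw [h, mul_zero], fun h => (h0 h).2⟩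
    · rintro δ ⟨hδ, b, c, hbc⟩
      obtain ⟨l, hl, hlm, rfl⟩ := (hP _).1 hδ
      have h1 := hbc.mul_eq
      rw [hxy] at h1
      simp only [LocalRep.params] at h1
      rw [two_cos_sq_inj hm hkm hlm (by rw [pow_two (2 * Real.cos (l * Real.pi / _))]; exact_mod_cast h1)]

end LocalClassification

/-! ### IR-representations as matrices up to diagonal conjugation -/

section Matrices

variable {S : Type*} {M : CoxeterMatrix S} {W : Type*} [Group W] {cs : CoxeterSystem M W}
  {V : Type*} [AddCommGroup V] [Module ℂ V] {ρ : Representation ℂ W V}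
  {V' : Type*} [AddCommGroup V'] [Module ℂ V'] {ρ' : Representation ℂ W V'}
  {α β : Module.Basis S ℂ V} {α' : Module.Basis S ℂ V'} {A B A' : S → S → ℂ}

variable (cs ρ α A) in
/-- The generators act on the basis `α` by `s·α_t = α_t + A_{st} α_s`, with `A_{ss} = -2`. -/
def HasMatrix : Prop :=
  (∀ s, A s s = -2) ∧ ∀ s t, ρ (cs.simple s) (α t) = α t + A s t • α s

theorem HasMatrix.exists_functional (h : HasMatrix cs ρ α A) (s : S) :
    ∃ f : V →ₗ[ℂ] ℂ, (∀ t, f (α t) = A s t) ∧ ∀ v, ρ (cs.simple s) v = v + f v • α s := by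
  refine ⟨α.constr ℂ (A s), fun t => α.constr_basis ℂ _ t, fun v => ?_⟩
  have : ρ (cs.simple s) = LinearMap.id + (α.constr ℂ (A s)).smulRight (α s) :=
    α.ext fun t => by simp [h.2, α.constr_basis]
  rw [this]
  simp

theorem HasMatrix.apply_self (h : HasMatrix cs ρ α A) (s : S) :
    ρ (cs.simple s) (α s) = -α s := by
  rw [h.2, h.1]
  module

theorem HasMatrix.isIRBasis (h : HasMatrix cs ρ α A) : IsIRBasis cs ρ α := fun s => by
  obtain ⟨f, hf, hρ⟩ := h.exists_functional s
  refine ⟨⟨LinearMap.ker f, ?_, fun v hv => ?_⟩, h.apply_self s⟩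
  · have hf0 : f ≠ 0 := fun h0 => by
      have := hf s
      rw [h0, h.1] at this
      norm_num at this
    rw [f.quotKerEquivOfSurjective (LinearMap.surjective hf0) |>.finrank_eq, Module.finrank_self]
  · rw [hρ, LinearMap.mem_ker.1 hv, zero_smul, add_zero]

/-- The vector `α_s` is negated, hence not in `H_s`, so its class spans `V / H_s`. If `α_t ≡ c α_s`
modulo `H_s`, then `s` fixes `c α_s - α_t`, which gives `A_{st} = -2c`. -/
theorem IsIRBasis.exists_hasMatrix (h : IsIRBasis cs ρ α) : ∃ A, HasMatrix cs ρ α A := by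
  have key : ∀ s t, ∃ c : ℂ, ρ (cs.simple s) (α t) = α t + c • α s := by
    intro s t
    obtain ⟨⟨H, hH, hfix⟩, hs⟩ := h s
    have hne : H.mkQ (α s) ≠ 0 := fun h0 => by
      have h1 := hfix _ ((Submodule.Quotient.mk_eq_zero H).1 h0)
      rw [hs] at h1
      apply α.ne_zero s
      linear_combination (norm := module) (-1 / 2 : ℂ) • h1
    obtain ⟨c, hc⟩ := (finrank_eq_one_iff_of_nonzero' _ hne).1 hH (H.mkQ (α t))
    have hmem : c • α s - α t ∈ H := by
      rw [← Submodule.Quotient.mk_eq_zero, ← Submodule.mkQ_apply, map_sub, map_smul, hc, sub_self]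
    have h2 := hfix _ hmem
    rw [map_sub, map_smul, hs] at h2
    refine ⟨-2 * c, ?_⟩
    linear_combination (norm := module) -h2
  choose A hA using key
  refine ⟨A, fun s => ?_, hA⟩
  have h1 := hA s s
  rw [(h s).2] at h1
  have h2 : (A s s + 2) • α s = 0 := by linear_combination (norm := module) -h1
  have := (smul_eq_zero.1 h2).resolve_right (α.ne_zero s)
  linear_combination this

theorem pair_linearIndependent (α : Module.Basis S ℂ V) {r t : S} (h : r ≠ t) :
    LinearIndependent ℂ ![α r, α t] := by
  have := α.linearIndependent.comp ![r, t] (by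
    intro i j
    fin_cases i <;> fin_cases j <;> simp [h, h.symm])
  convert this using 1
  ext i
  fin_cases i <;> rfl

theorem isLocalIso_iff (h : HasMatrix cs ρ α A) (u : ℂ → ℂ) {r t : S} (hrt : r ≠ t)
    (δ : LocalRep S) (b c : ℂˣ) :
    IsLocalIso cs ρ u α r t δ b c ↔
      Rescales (δ.params u (M r t) r t) (A r t) (A t r) b c := by
  have hli := pair_linearIndependent α hrt
  have hr := α.ne_zero r
  have ht := α.ne_zero t
  constructor
  · rintro ⟨φ, hb, hc, hφ⟩
    constructor
    · have h1 := (hφ ![0, 1]).1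
      have h2 : actFst (δ.params u (M r t) r t).1 ![0, 1]
          = (δ.params u (M r t) r t).1 • ![1, 0] + ![0, 1] := by
        ext i
        fin_cases i <;> simp [actFst, Matrix.toLin'_apply]
      rw [h2, map_add, map_smul, Submodule.coe_add, Submodule.coe_smul, hb, hc, map_smul,
        h.2 r t] at h1
      apply sub_eq_zero.1 ((smul_eq_zero.1 (?_ :
        ((c : ℂ) * A r t - b * (δ.params u (M r t) r t).1) • α r = 0)).resolve_right hr)
      linear_combination (norm := module) -h1
    · have h1 := (hφ ![1, 0]).2
      have h2 : actSnd (δ.params u (M r t) r t).2 ![1, 0]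
          = ![1, 0] + (δ.params u (M r t) r t).2 • ![0, 1] := by
        ext i
        fin_cases i <;> simp [actSnd, Matrix.toLin'_apply]
      rw [h2, map_add, map_smul, Submodule.coe_add, Submodule.coe_smul, hb, hc, map_smul,
        h.2 t r] at h1
      apply sub_eq_zero.1 ((smul_eq_zero.1 (?_ :
        ((b : ℂ) * A t r - c * (δ.params u (M r t) r t).2) • α t = 0)).resolve_right ht)
      linear_combination (norm := module) -h1
  · rintro ⟨h1, h2⟩
    set p := δ.params u (M r t) r t
    let ψ : (Fin 2 → ℂ) →ₗ[ℂ] Submodule.span ℂ {α r, α t} :=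
      (LinearMap.proj 0).smulRight ⟨(b : ℂ) • α r, Submodule.smul_mem _ _
        (Submodule.subset_span (by simp))⟩ +
      (LinearMap.proj 1).smulRight ⟨(c : ℂ) • α t, Submodule.smul_mem _ _
        (Submodule.subset_span (by simp))⟩
    have hψ : ∀ v, (ψ v : V) = v 0 • (b : ℂ) • α r + v 1 • (c : ℂ) • α t := fun v => rfl
    have hinj : Function.Injective ψ := by
      rw [injective_iff_map_eq_zero]
      intro v hv
      have h3 := congrArg Subtype.val hv
      rw [hψ, smul_smul, smul_smul] at h3
      have := LinearIndependent.pair_iff.1 hli _ _ h3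
      ext i
      fin_cases i
      · simpa using this.1
      · simpa using this.2
    have hsurj : Function.Surjective ψ := by
      rintro ⟨w, hw⟩
      obtain ⟨p, q, rfl⟩ := Submodule.mem_span_pair.1 hw
      refine ⟨![p * (b : ℂ)⁻¹, q * (c : ℂ)⁻¹], Subtype.ext ?_⟩
      rw [hψ]
      simp [smul_smul]
    refine ⟨LinearEquiv.ofBijective ψ ⟨hinj, hsurj⟩, ?_, ?_, fun v => ⟨?_, ?_⟩⟩
    · exact (hψ _).trans (by simp)
    · exact (hψ _).trans (by simp)
    · change (ψ (actFst p.1 v) : V) = ρ _ (ψ v : V)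
      simp only [hψ, map_add, map_smul, h.2 r t, h.apply_self r]
      have h3 : actFst p.1 v 0 = -v 0 + p.1 * v 1 := by
        simp [actFst, Matrix.toLin'_apply, Matrix.mulVec, dotProduct]
      have h4 : actFst p.1 v 1 = v 1 := by
        simp [actFst, Matrix.toLin'_apply, Matrix.mulVec, dotProduct]
      rw [h3, h4]
      linear_combination (norm := module) -v 1 • h1 • (α r)
    · change (ψ (actSnd p.2 v) : V) = ρ _ (ψ v : V)
      simp only [hψ, map_add, map_smul, h.2 t r, h.apply_self t]
      have h3 : actSnd p.2 v 0 = v 0 := by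
        simp [actSnd, Matrix.toLin'_apply, Matrix.mulVec, dotProduct]
      have h4 : actSnd p.2 v 1 = p.2 * v 0 - v 1 := by
        simp [actSnd, Matrix.toLin'_apply, Matrix.mulVec, dotProduct, sub_eq_add_neg]
      rw [h3, h4]
      linear_combination (norm := module) -v 0 • h2 • (α t)

theorem correspondsTo_iff {u : ℂ → ℂ} {D : Datum M} :
    CorrespondsTo cs ρ u D ↔ ∃ (α : Module.Basis S ℂ V) (A : S → S → ℂ) (a : S → S → ℂˣ),
      HasMatrix cs ρ α A ∧
      (∀ (r t : S) (h : r ≠ t), Rescales ((D.loc.δ r t h).params u (M r t) r t) (A r t) (A t r)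
        (a r t) (a t r)) ∧
      D.χ = characterOf D.loc.graph a := by
  constructor
  · rintro ⟨α, a, hIR, hloc, hχ⟩
    obtain ⟨A, hA⟩ := hIR.exists_hasMatrix
    exact ⟨α, A, a, hA, fun r t h => (isLocalIso_iff hA u h _ _ _).1 (hloc r t h), hχ⟩
  · rintro ⟨α, A, a, hA, hloc, hχ⟩
    exact ⟨α, a, hA.isIRBasis, fun r t h => (isLocalIso_iff hA u h _ _ _).2 (hloc r t h), hχ⟩

theorem HasMatrix.admissible (h : HasMatrix cs ρ α A) {r t : S} (hrt : r ≠ t) :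
    Admissible (M r t) (A r t) (A t r) :=
  admissible_of_pow_eq_one (pair_linearIndependent α hrt) (h.apply_self r) (h.2 r t)
    (h.apply_self t) (h.2 t r) (by
      rw [← map_mul, ← map_pow, cs.simple_mul_simple_pow, map_one])

variable (cs α) in
theorem exists_hasMatrix (hA : ∀ s, A s s = -2)
    (hadm : ∀ r t, r ≠ t → Admissible (M r t) (A r t) (A t r)) :
    ∃ ρ : Representation ℂ W V, HasMatrix cs ρ α A := by
  let σ : S → Module.End ℂ V := fun s =>
    LinearMap.id + (α.constr ℂ (A s)).smulRight (α s)
  have hσ : ∀ s v, σ s v = v + α.constr ℂ (A s) v • α s := fun s v => by simp [σ]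
  have hσα : ∀ s t, σ s (α t) = α t + A s t • α s := fun s t => by
    rw [hσ, α.constr_basis]
  have hσs : ∀ s, σ s (α s) = -α s := fun s => by
    rw [hσα, hA]
    module
  have hlift : M.IsLiftable σ := by
    intro r t
    by_cases h : r = t
    · subst h
      rw [M.diagonal, pow_one]
      refine α.ext fun t => ?_
      rw [Module.End.mul_apply, hσα, map_add, map_smul, hσα, hσs, Module.End.one_apply]
      module
    · exact pow_eq_one_of_admissible (hσ r) (hσ t) (hσs r) (hσα r t) (hσs t) (hσα t r) (hadm r t h)
  refine ⟨cs.lift ⟨σ, hlift⟩, hA, fun s t => ?_⟩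
  rw [cs.lift_apply_simple hlift]
  exact hσα s t

theorem HasMatrix.map (h : HasMatrix cs ρ α A) (e : ρ.Equiv ρ') :
    HasMatrix cs ρ' (α.map e.toLinearEquiv) A := by
  refine ⟨h.1, fun s t => ?_⟩
  have h1 : ρ' (cs.simple s) (e (α t)) = e (ρ (cs.simple s) (α t)) :=
    (Representation.IntertwiningMap.isIntertwining _ _ e.toIntertwiningMap (cs.simple s) (α t)).symm
  have h2 : ∀ s, α.map e.toLinearEquiv s = e (α s) := fun s => rfl
  rw [h2, h2, h1, h.2, map_add, map_smul]

theorem CorrespondsTo.map {u : ℂ → ℂ} {D : Datum M} (h : CorrespondsTo cs ρ u D)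
    (e : ρ.Equiv ρ') : CorrespondsTo cs ρ' u D := by
  obtain ⟨α, A, a, hA, hloc⟩ := correspondsTo_iff.1 h
  exact correspondsTo_iff.2 ⟨_, A, a, hA.map e, hloc⟩

/-- Any vector negated by `s` is a multiple of `α_s`, because `s·v - v` always is. -/
theorem HasMatrix.exists_rescaling (h : HasMatrix cs ρ α A) (h' : HasMatrix cs ρ β B) :
    ∃ l : S → ℂˣ, ∀ r t, B r t = A r t * (l t / l r) := by
  have key : ∀ s, ∃ c : ℂˣ, β s = (c : ℂ) • α s := by
    intro s
    obtain ⟨f, -, hf⟩ := h.exists_functional s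
    have h1 := hf (β s)
    rw [h'.apply_self] at h1
    have h2 : β s = (-f (β s) / 2) • α s := by linear_combination (norm := module) (-1/2 : ℂ) • h1
    have h3 : -f (β s) / 2 ≠ 0 := fun h0 => by
      rw [h0, zero_smul] at h2
      exact β.ne_zero s h2
    exact ⟨Units.mk0 _ h3, h2⟩
  choose l hl using key
  refine ⟨l, fun r t => ?_⟩
  have h1 := h'.2 r t
  rw [hl, hl, map_smul, h.2] at h1
  have h2 : (B r t * l r - A r t * l t) • α r = 0 := by linear_combination (norm := module) -h1
  have h3 := sub_eq_zero.1 ((smul_eq_zero.1 h2).resolve_right (α.ne_zero r))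
  field_simp
  exact h3

/-- The map `α_t ↦ l_t⁻¹ α'_t` intertwines the generators, hence all of `W`. -/
theorem HasMatrix.nonempty_equiv (h : HasMatrix cs ρ α A) (h' : HasMatrix cs ρ' α' A')
    (l : S → ℂˣ) (hl : ∀ r t, A' r t = A r t * (l t / l r)) : Nonempty (ρ.Equiv ρ') := by
  let e : V ≃ₗ[ℂ] V' := α.equiv (α'.unitsSMul fun s => (l s)⁻¹) (Equiv.refl S)
  have he : ∀ s, e (α s) = (l s : ℂ)⁻¹ • α' s := fun s => by
    simp [e, Module.Basis.unitsSMul_apply, Units.smul_def]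
  have hs : ∀ s, e.toLinearMap ∘ₗ ρ (cs.simple s) = ρ' (cs.simple s) ∘ₗ e.toLinearMap := by
    intro s
    refine α.ext fun t => ?_
    simp only [LinearMap.comp_apply, LinearEquiv.coe_coe]
    rw [h.2, map_add, map_smul, he, he, map_smul, h'.2, hl, smul_add, smul_smul, smul_smul]
    congr 2
    field_simp
  refine ⟨Representation.Equiv.mk e fun g => ?_⟩
  induction g using cs.simple_induction with
  | simple s => exact hs s
  | one => rw [map_one, map_one]; rfl
  | mul g g' hg hg' =>
    rw [map_mul, map_mul, Module.End.mul_eq_comp, Module.End.mul_eq_comp, ← LinearMap.comp_assoc,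
      hg, LinearMap.comp_assoc, hg', LinearMap.comp_assoc]

end Matrices

/-! ### Existence and uniqueness of the datum and of the representation -/

section Classification

variable {S : Type*} {M : CoxeterMatrix S} {W : Type*} [Group W] {cs : CoxeterSystem M W}
  {V : Type*} [AddCommGroup V] [Module ℂ V] {ρ : Representation ℂ W V}
  {V' : Type*} [AddCommGroup V'] [Module ℂ V'] {ρ' : Representation ℂ W V'} {u : ℂ → ℂ}

theorem LocalData.graph_adj_iff (hu : ∀ z, u z ^ 2 = z) (L : LocalData M) {r t : S} :
    L.graph.Adj r t ↔ ∃ h : r ≠ t, (L.δ r t h).params u (M r t) r t ≠ (0, 0) := by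
  change (r ≠ t ∧ L.tilde r t ≠ 2) ↔ _
  rw [← exists_prop]
  refine exists_congr fun h => ?_
  have : L.tilde r t = (L.δ r t h).mTilde (M r t) := dif_neg h
  rw [this, ne_eq, ne_eq, params_eq_zero_iff hu (L.mem r t h)]

/-- The type of `χ` depends on `loc`; presenting both characters by scalars `a`, `a'` lets them be
compared on one graph. -/
theorem Datum.ext_of_loc {D D' : Datum M} (h : D.loc = D'.loc)
    (hχ : ∀ a a', D.χ = characterOf D.loc.graph a → D'.χ = characterOf D'.loc.graph a' →
      characterOf D.loc.graph a = characterOf D.loc.graph a') : D = D' := by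
  obtain ⟨L, χ⟩ := D
  obtain ⟨L', χ'⟩ := D'
  obtain rfl : L = L' := h
  obtain ⟨a, rfl⟩ := exists_eq_characterOf L.graph χ
  obtain ⟨a', rfl⟩ := exists_eq_characterOf L.graph χ'
  rw [hχ a a' rfl rfl]

theorem exists_correspondsTo (hu : ∀ z, u z ^ 2 = z) (h : IsIR cs ρ) :
    ∃ D : Datum M, CorrespondsTo cs ρ u D := by
  obtain ⟨α, hα⟩ := h
  obtain ⟨A, hA⟩ := hα.exists_hasMatrix
  have hex := fun r t (h : r ≠ t) => existsUnique_localRep hu h (hA.admissible h)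
  choose δ hδ huniq using hex
  let L : LocalData M :=
    { δ := δ
      mem := fun r t h => (hδ r t h).1
      symm := fun r t h => by
        obtain ⟨hmem, b, c, hbc⟩ := hδ r t h
        refine huniq t r h.symm _ ⟨P_symm r t ▸ hmem, c, b, ?_⟩
        rw [params_symm h hmem]
        exact hbc.swap }
  obtain ⟨a, ha⟩ := exists_forall_pair (S := S) (X := ℂˣ)
    (fun r t h b c => Rescales ((L.δ r t h).params u (M r t) r t) (A r t) (A t r) b c)
    (fun r t h b c hbc => by
      rw [← L.symm r t h, params_symm h (L.mem r t h)]
      exact hbc.swap)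
    (fun r t h => (hδ r t h).2)
  exact ⟨⟨L, characterOf L.graph a⟩, correspondsTo_iff.2 ⟨α, A, a, hA, ha, rfl⟩⟩

/-- On an edge some parameter is nonzero, so the matrix entries determine the ratio `c / b`. -/
theorem Rescales.div_eq {p : ℂ × ℂ} {x y x' y' : ℂ} {b c b' c' l m : ℂˣ} (h : Rescales p x y b c)
    (h' : Rescales p x' y' b' c') (hp : p ≠ (0, 0)) (hx : x' = x * (m / l))
    (hy : y' = y * (l / m)) : c / b = c' / b' * (m / l) := by
  obtain ⟨p, q⟩ := p
  have hor : p ≠ 0 ∨ q ≠ 0 := by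
    by_contra! h0
    exact hp (by rw [h0.1, h0.2])
  obtain ⟨h1, h2⟩ := h
  obtain ⟨h1', h2'⟩ := h'
  subst hx hy
  simp only at h1 h2 h1' h2'
  ext
  push_cast
  field_simp at h1' h2' ⊢
  rcases hor with hp0 | hq0
  · apply mul_right_cancel₀ hp0
    have hx0 : x ≠ 0 := by
      rintro rfl
      exact mul_ne_zero b.ne_zero hp0 (by rw [← h1, mul_zero])
    apply mul_right_cancel₀ hx0
    linear_combination (-(c : ℂ)) * x * h1' + (c' : ℂ) * m * x * h1
  · apply mul_right_cancel₀ hq0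
    have hy0 : y ≠ 0 := by
      rintro rfl
      exact mul_ne_zero c.ne_zero hq0 (by rw [← h2, mul_zero])
    apply mul_right_cancel₀ hy0
    linear_combination (b : ℂ) * y * h2' - (b' : ℂ) * l * y * h2

theorem Rescales.eq_mul {p : ℂ × ℂ} {x y x' y' : ℂ} {b c b' c' l m : ℂˣ} (h : Rescales p x y b c)
    (h' : Rescales p x' y' b' c') (hd : c / b = c' / b' * (m / l)) : x' = x * (m / l) := by
  have hd' := congrArg Units.val hd
  push_cast at hd'
  field_simp at hd' ⊢
  apply mul_left_cancel₀ (mul_ne_zero c.ne_zero c'.ne_zero)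
  linear_combination (c : ℂ) * l * h'.1 - (c' : ℂ) * m * h.1 + p.1 * hd'

theorem CorrespondsTo.unique (hu : ∀ z, u z ^ 2 = z) {D D' : Datum M}
    (h : CorrespondsTo cs ρ u D) (h' : CorrespondsTo cs ρ u D') : D = D' := by
  obtain ⟨α, A, a, hA, ha, hχ⟩ := correspondsTo_iff.1 h
  obtain ⟨α', A', a', hA', ha', hχ'⟩ := correspondsTo_iff.1 h'
  obtain ⟨l, hl⟩ := hA.exists_rescaling hA'
  have hloc : D.loc = D'.loc := by
    ext r t h
    -- Since `A'_{rt} = A_{rt} l_t / l_r`, the scalars `a'_r^t l_r` and `a'_t^r l_t` relate the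
    -- second local datum to the first matrix.
    refine (existsUnique_localRep hu h (hA.admissible h)).unique
      ⟨D.loc.mem r t h, _, _, ha r t h⟩ ⟨D'.loc.mem r t h, a' r t * l r, a' t r * l t, ?_⟩
    obtain ⟨h1, h2⟩ := ha' r t h
    rw [hl] at h1 h2
    constructor
    · push_cast
      field_simp at h1
      linear_combination h1
    · push_cast
      field_simp at h2
      linear_combination h2
  refine Datum.ext_of_loc hloc fun b b' hb hb' => ?_
  have hδ : ∀ r t h, D.loc.δ r t h = D'.loc.δ r t h := fun r t h => by rw [hloc]
  rw [← hb, hχ]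
  have h1 : characterOf D.loc.graph b' = characterOf D.loc.graph a' := by
    have h2 := hb'.symm.trans hχ'
    rw [← hloc] at h2
    exact h2
  rw [h1, characterOf_eq_iff]
  refine ⟨l, fun r t hrt => ?_⟩
  obtain ⟨hne, hp⟩ := (LocalData.graph_adj_iff hu D.loc).1 hrt
  have h3 := ha' r t hne
  rw [← hδ] at h3
  exact (ha r t hne).div_eq h3 hp (hl r t) (hl t r)

theorem CorrespondsTo.nonempty_equiv (hu : ∀ z, u z ^ 2 = z) {D : Datum M}
    (h : CorrespondsTo cs ρ u D) (h' : CorrespondsTo cs ρ' u D) : Nonempty (ρ.Equiv ρ') := by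
  obtain ⟨α, A, a, hA, ha, hχ⟩ := correspondsTo_iff.1 h
  obtain ⟨α', A', a', hA', ha', hχ'⟩ := correspondsTo_iff.1 h'
  obtain ⟨l, hl⟩ := (characterOf_eq_iff _ a a').1 (hχ.symm.trans hχ')
  refine hA.nonempty_equiv hA' l fun r t => ?_
  by_cases hrt : r = t
  · subst hrt
    rw [hA.1, hA'.1, div_self (l r).ne_zero, mul_one]
  -- On edges the ratios determine the entries; off edges both entries are zero, so `l` imposes
  -- nothing.
  · by_cases hadj : D.loc.graph.Adj r t
    · exact (ha r t hrt).eq_mul (ha' r t hrt) (hl r t hadj)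
    · have hp : (D.loc.δ r t hrt).params u (M r t) r t = (0, 0) := by
        by_contra hp
        exact hadj ((LocalData.graph_adj_iff hu D.loc).2 ⟨hrt, hp⟩)
      rw [(ha r t hrt).fst_eq_zero.2 (by rw [hp]), (ha' r t hrt).fst_eq_zero.2 (by rw [hp]),
        zero_mul]

theorem exists_representation_correspondsTo (cs : CoxeterSystem M W) (α : Module.Basis S ℂ V)
    (D : Datum M) : ∃ ρ : Representation ℂ W V, CorrespondsTo cs ρ u D := by
  classical
  obtain ⟨a, ha⟩ := exists_eq_characterOf D.loc.graph D.χ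
  let A : S → S → ℂ := fun r t => if h : r = t then -2 else
    (a r t / a t r : ℂ) * ((D.loc.δ r t h).params u (M r t) r t).1
  have hA : ∀ r t (h : r ≠ t), Rescales ((D.loc.δ r t h).params u (M r t) r t) (A r t) (A t r)
      (a r t) (a t r) := by
    intro r t h
    constructor
    · simp only [A, dif_neg h]
      field_simp
    · simp only [A, dif_neg h.symm]
      rw [← D.loc.symm r t h, params_symm h (D.loc.mem r t h), Prod.fst_swap]
      field_simp
  obtain ⟨ρ, hρ⟩ := exists_hasMatrix (A := A) cs α (fun s => by simp [A])
    (fun r t h => admissible_of_rescales (D.loc.mem r t h) (hA r t h))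
  exact ⟨ρ, correspondsTo_iff.2 ⟨α, A, a, hρ, hA, ha⟩⟩

theorem CorrespondsTo.isIR {D : Datum M} (h : CorrespondsTo cs ρ u D) : IsIR cs ρ := by
  obtain ⟨α, a, hα, -⟩ := h
  exact ⟨α, hα⟩

end Classification

end CoxIR

end

theorem mainTheorem2 {S : Type s} [Finite S] (M : CoxeterMatrix S)
    {W : Type w} [Group W] (cs : CoxeterSystem M W)
    (u : ℂ → ℂ) (hu : ∀ z, u z ^ 2 = z)
    (hu_pos : ∀ x : ℝ, 0 < x → u (x : ℂ) = ((Real.sqrt x : ℝ) : ℂ)) :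
    ∃ Θ : CoxIR.IRIsoClass.{v} cs → CoxIR.Datum M,
      Function.Bijective Θ ∧
      ∀ (V : CoxIR.IRRep.{v} cs) (D : CoxIR.Datum M),
        Θ V.isoClass = D ↔ CoxIR.CorrespondsTo cs V.1.ρ u D := by
  have hex := fun V : CoxIR.IRRep.{v} cs => CoxIR.exists_correspondsTo hu V.2
  choose θ hθ using hex
  have hiff : ∀ V D, θ V = D ↔ CoxIR.CorrespondsTo cs V.1.ρ u D := fun V D =>
    ⟨fun h => h ▸ hθ V, fun h => (hθ V).unique hu h⟩
  refine ⟨Quotient.lift θ ?_, ⟨?_, ?_⟩, hiff⟩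
  · rintro V V' ⟨e⟩
    exact ((hiff V' _).2 ((hθ V).map (Representation.equivOfIso e))).symm
  · intro x y
    refine Quotient.inductionOn₂ x y fun V V' h => Quotient.sound ?_
    obtain ⟨e⟩ := (hθ V).nonempty_equiv hu ((hiff V' _).1 h.symm)
    exact ⟨Rep.mkIso e⟩
  · intro D
    obtain ⟨n, ⟨e⟩⟩ := Finite.exists_equiv_fin S
    -- Surjectivity needs a space of dimension `|S|` in the prescribed universe.
    let α : Module.Basis S ℂ (ULift.{v} (Fin n → ℂ)) :=
      ((Pi.basisFun ℂ (Fin n)).map ULift.moduleEquiv.symm).reindex e.symm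
    obtain ⟨ρ, hρ⟩ := CoxIR.exists_representation_correspondsTo (u := u) cs α D
    exact ⟨CoxIR.IRRep.isoClass ⟨Rep.of ρ, hρ.isIR⟩, (hiff _ D).2 hρ⟩
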